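/- Let $\alpha=(\alpha_n)_{n\ge1}$ be a strictly increasing sequence of positive reals with $\alpha_n\to\infty$, and let $(s_k)_{k\ge1}\subset(1,\infty)$ be strictly increasing with $s_k\to\infty$. Put $v_k(n)=s_k^{-\alpha_n}$ and let $c_0(v_k)$ be the space of complex sequences $x$ with $v_k(n)x_n\to0$, normed by $\sup_n v_k(n)|x_n|$. Let $E_\alpha=\operatorname{ind}_k c_0(v_k)$, i.e. $E_\alpha=\bigcup_k c_0(v_k)$ with the finest locally convex Hausdorff topology for which all inclusions $c_0(v_k)\hookrightarrow E_\alpha$ are continuous. Let $\mathcal L_b(E_\alpha)$ be the space of continuous linear operators on $E_\alpha$ with the topology of uniform convergence on bounded sets. Then the Cesàro operator $(\mathsf Cx)_n=\frac{x_1+\dots+x_n}{n}$ is a continuous linear operator $\mathsf C\colon E_\alpha\to E_\alpha$, the constant sequence $\mathbf 1=(1,1,\dots)$ lies in $E_\alpha$, and there is a continuous linear projection $P$ on $E_\alpha$ with range $\operatorname{span}\{\mathbf 1\}$ and kernel $\overline{(I-\mathsf C)(E_\alpha)}$ (closure in $E_\alpha$) such that $\mathsf C^m\to P$ in $\mathcal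 L_b(E_\alpha)$ as $m\to\infty$. -/

import Mathlib

open Filter Topology

noncomputable section

namespace CesaroCoechelon

/-- Sequences `x` with `v(n) x(n) → 0`, as a linear subspace of the space of all complex
sequences. Sequences are indexed from `0`: `x 0` is the first entry. -/
def c0Submodule (v : ℕ → ℝ) : Submodule ℂ (ℕ → ℂ) where
  carrier := {x | Tendsto (fun n => (v n : ℂ) * x n) atTop (𝓝 0)}
  zero_mem' := by simp
  add_mem' := by
    intro x y hx hy
    simpa [mul_add] using Tendsto.add hx hy
  smul_mem' := by
    intro c x hx
    have h := Tendsto.const_mul c hx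
    simpa [mul_left_comm] using h

/-- The weighted space `c₀(v)`, as a type of its own (so that it does not inherit the topology
of the sequence space). -/
def C0 (v : ℕ → ℝ) : Type := c0Submodule v

namespace C0

variable {v : ℕ → ℝ}

instance : AddCommGroup (C0 v) := inferInstanceAs (AddCommGroup (c0Submodule v))

instance : Module ℂ (C0 v) := inferInstanceAs (Module ℂ (c0Submodule v))

/-- The sequence underlying an element of `c₀(v)`. -/
def toSeq : C0 v →ₗ[ℂ] (ℕ → ℂ) := (c0Submodule v).subtype

theorem tendsto (x : C0 v) : Tendsto (fun n => (v n : ℂ) * toSeq x n) atTop (𝓝 0) := x.2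

theorem bddAbove (x : C0 v) : BddAbove (Set.range fun n => ‖(v n : ℂ) * toSeq x n‖) :=
  (x.tendsto.norm).bddAbove_range

/-- The norm `q(x) = sup_n v(n) |x_n|` of `c₀(v)` (for a positive weight `v`). -/
def q (v : ℕ → ℝ) : Seminorm ℂ (C0 v) :=
  Seminorm.of (fun x => ⨆ n, ‖(v n : ℂ) * toSeq x n‖)
    (by
      intro x y
      refine ciSup_le fun n => ?_
      have h : (v n : ℂ) * toSeq (x + y) n = v n * toSeq x n + v n * toSeq y n := by
        simp [mul_add]
      rw [h]
      exact (norm_add_le _ _).trans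
        (add_le_add (le_ciSup x.bddAbove n) (le_ciSup y.bddAbove n)))
    (by
      intro c x
      rw [Real.mul_iSup_of_nonneg (norm_nonneg c)]
      refine iSup_congr fun n => ?_
      simp only [map_smul, Pi.smul_apply, smul_eq_mul, norm_mul]
      ring)

instance : SeminormedAddCommGroup (C0 v) := (q v).toAddGroupSeminorm.toSeminormedAddCommGroup

instance : NormedSpace ℂ (C0 v) where
  norm_smul_le c x := (map_smul_eq_mul (q v) c x).le

theorem norm_def (x : C0 v) : ‖x‖ = ⨆ n, ‖(v n : ℂ) * toSeq x n‖ := rfl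

end C0

/-- The vector space underlying the co-echelon space of a sequence of weights `v k`: the linear
span of all the `c₀(v k)`, which is their union when `v k` decreases in `k`
(see `IndC0.exists_mem`). -/
def indSubmodule (v : ℕ → ℕ → ℝ) : Submodule ℂ (ℕ → ℂ) := ⨆ k, c0Submodule (v k)

/-- The co-echelon space `ind_k c₀(v k)`, as a type of its own. -/
def IndC0 (v : ℕ → ℕ → ℝ) : Type := indSubmodule v

namespace IndC0

variable {v : ℕ → ℕ → ℝ}

instance : AddCommGroup (IndC0 v) := inferInstanceAs (AddCommGroup (indSubmodule v))

instance : Module ℂ (IndC0 v) := inferInstanceAs (Module ℂ (indSubmodule v))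

/-- The sequence underlying an element of the co-echelon space. -/
def toSeq : IndC0 v →ₗ[ℂ] (ℕ → ℂ) := (indSubmodule v).subtype

/-- The natural inclusion of the step `c₀(v k)` into the co-echelon space. -/
def incl (v : ℕ → ℕ → ℝ) (k : ℕ) : C0 (v k) →ₗ[ℂ] IndC0 v :=
  Submodule.inclusion (le_iSup (fun k => c0Submodule (v k)) k)

@[simp]
theorem toSeq_incl (k : ℕ) (x : C0 (v k)) : toSeq (incl v k x) = C0.toSeq x := rfl

theorem toSeq_injective : Function.Injective (toSeq : IndC0 v → ℕ → ℂ) :=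
  Subtype.val_injective

/-- The inductive limit topology: the finest locally convex vector space topology for which all
the inclusions `c₀(v k) → ind_k c₀(v k)` are continuous. It is Hausdorff when the weights do not
vanish (see `IndC0.t2Space`). -/
instance : TopologicalSpace (IndC0 v) :=
  sInf {t : TopologicalSpace (IndC0 v) |
    (∀ k, @Continuous _ _ _ t (incl v k)) ∧
    @IsTopologicalAddGroup (IndC0 v) t _ ∧
    @ContinuousSMul ℂ (IndC0 v) _ _ t ∧
    @LocallyConvexSpace ℝ (IndC0 v) _ _ _ _ t}

instance : IsTopologicalAddGroup (IndC0 v) :=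
  topologicalAddGroup_sInf fun _ ⟨_, ht, _, _⟩ => ht

instance : ContinuousSMul ℂ (IndC0 v) :=
  continuousSMul_sInf fun _ ⟨_, _, ht, _⟩ => ht

instance : LocallyConvexSpace ℝ (IndC0 v) :=
  .sInf fun _ ⟨_, _, _, ht⟩ => ht

theorem continuous_incl (k : ℕ) : Continuous (incl v k) :=
  continuous_sInf_rng.2 fun _ ⟨ht, _⟩ => ht k

/-- The topology is the finest one with these properties. -/
theorem topology_le {t : TopologicalSpace (IndC0 v)} (h : ∀ k, @Continuous _ _ _ t (incl v k))
    (h₁ : @IsTopologicalAddGroup (IndC0 v) t _) (h₂ : @ContinuousSMul ℂ (IndC0 v) _ _ t)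
    (h₃ : @LocallyConvexSpace ℝ (IndC0 v) _ _ _ _ t) :
    instTopologicalSpace ≤ t :=
  sInf_le ⟨h, h₁, h₂, h₃⟩

/-- The co-echelon space is the union of its steps when the weights decrease in `k`. -/
theorem exists_mem (h0 : ∀ k n, 0 ≤ v k n) (hv : ∀ n, Antitone fun k => v k n) (x : IndC0 v) :
    ∃ k, ∃ y : C0 (v k), incl v k y = x := by
  have hdir : Monotone fun k => c0Submodule (v k) := by
    intro k l hkl y hy
    refine squeeze_zero_norm (fun n => ?_) (tendsto_zero_iff_norm_tendsto_zero.1 hy)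
    simp only [norm_mul, Complex.norm_real, Real.norm_eq_abs, abs_of_nonneg (h0 _ _)]
    exact mul_le_mul_of_nonneg_right (hv n hkl) (norm_nonneg _)
  obtain ⟨k, hk⟩ := (Submodule.mem_iSup_of_directed _ hdir.directed_le).1 x.2
  exact ⟨k, ⟨x.1, hk⟩, rfl⟩

/-- The inductive limit topology is Hausdorff when the weights do not vanish. -/
theorem t2Space (hv : ∀ k n, v k n ≠ 0) : T2Space (IndC0 v) := by
  have hle : (instTopologicalSpace : TopologicalSpace (IndC0 v)) ≤
      TopologicalSpace.induced toSeq inferInstance := by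
    refine topology_le (fun k => ?_) (topologicalAddGroup_induced _) (continuousSMul_induced _)
      (LocallyConvexSpace.induced (toSeq.restrictScalars ℝ : IndC0 v →ₗ[ℝ] (ℕ → ℂ)))
    refine continuous_induced_rng.2 (continuous_pi fun n => ?_)
    let f : C0 (v k) →ₗ[ℂ] ℂ := (LinearMap.proj n).comp C0.toSeq
    refine AddMonoidHomClass.continuous_of_bound f (|v k n|⁻¹) fun x => ?_
    have h1 : ‖(v k n : ℂ) * C0.toSeq x n‖ ≤ ‖x‖ := le_ciSup x.bddAbove n
    rw [norm_mul, Complex.norm_real, Real.norm_eq_abs] at h1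
    have h2 : 0 < |v k n| := abs_pos.2 (hv k n)
    rw [inv_mul_eq_div, le_div_iff₀ h2, mul_comm]
    exact h1
  have hc : Continuous (toSeq : IndC0 v → ℕ → ℂ) := continuous_iff_le_induced.2 hle
  exact T2Space.of_injective_continuous toSeq_injective hc

end IndC0

/-- The weights `v_k(n) = s_k ^ (-α_n)`. -/
def weight (α s : ℕ → ℝ) (k n : ℕ) : ℝ := s k ^ (-α n)

/-- The co-echelon space `E_α = ind_k c₀(v_k)`, defined with an auxiliary sequence `s` of bases. -/
abbrev E (α s : ℕ → ℝ) : Type := IndC0 (weight α s)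

/-- The discrete Cesàro operator `(C x)_n = (x_1 + ⋯ + x_n) / n` on all complex sequences
(here with indices shifted to start at `0`). -/
def cesaro (x : ℕ → ℂ) (n : ℕ) : ℂ := (∑ i ∈ Finset.range (n + 1), x i) / ((n : ℂ) + 1)

end CesaroCoechelon

end

open Filter Topology

noncomputable section

namespace CesaroCoechelon

/-! ### The Cesàro operator on sequences -/

/-! The limit is `P x = x 0 • 1`, since `C` preserves the entry at `0` and fixes constants. It
remains to show that `C^m (1 - P) → 0` uniformly on bounded sets, that is, to treat sequences
vanishing at `0`.

Two estimates compete. Weights decreasing in `n` make every `C^m` a contraction for each weighted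
sup norm. On the entries `0, …, N` of a sequence vanishing at `0`, `C` contracts the plain sup norm
by `N / (N + 1)`. A bounded set is bounded for a single weight `v k`
(`exists_forall_mem_mul_norm_le`). Measured with `v (k + 1)`, the tails are small uniformly in `m`
because `v (k + 1) / v k → 0`, and the heads decay geometrically
(`eventually_mul_norm_iterate_cesaro_le`).

The kernel follows: if `P x = 0`, then `x` is the limit of `x - C^m x`, which lies in the range of
`1 - C`. -/

/-- The Cesàro operator as a linear map on the space of all sequences. -/
def cesaroLin : (ℕ → ℂ) →ₗ[ℂ] (ℕ → ℂ) where
  toFun := cesaro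
  map_add' x y := by
    funext n
    simp [cesaro, Finset.sum_add_distrib, add_div]
  map_smul' c x := by
    funext n
    simp [cesaro, ← Finset.mul_sum, mul_div_assoc]

theorem norm_cesaro_le (x : ℕ → ℂ) (n : ℕ) :
    ‖cesaro x n‖ ≤ (∑ i ∈ Finset.range (n + 1), ‖x i‖) / ((n : ℝ) + 1) := by
  have h : ‖(n : ℂ) + 1‖ = (n : ℝ) + 1 := by
    exact_mod_cast Complex.norm_natCast (n + 1)
  rw [cesaro, norm_div, h]
  exact div_le_div_of_nonneg_right (norm_sum_le _ _) (by positivity)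

/-- A decreasing weight can be moved inside the average: `v n ≤ v i` for `i ≤ n`. -/
theorem mul_norm_cesaro_le {v : ℕ → ℝ} (h0 : ∀ n, 0 ≤ v n) (hv : Antitone v) (x : ℕ → ℂ) (n : ℕ) :
    v n * ‖cesaro x n‖ ≤ (∑ i ∈ Finset.range (n + 1), v i * ‖x i‖) / ((n : ℝ) + 1) := by
  refine (mul_le_mul_of_nonneg_left (norm_cesaro_le x n) (h0 n)).trans ?_
  rw [← mul_div_assoc, Finset.mul_sum]
  refine div_le_div_of_nonneg_right (Finset.sum_le_sum fun i hi => ?_) (by positivity)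
  exact mul_le_mul_of_nonneg_right (hv (Nat.lt_succ_iff.1 (Finset.mem_range.1 hi)))
    (norm_nonneg _)

theorem mul_norm_cesaro_le_of_forall_le {v : ℕ → ℝ} (h0 : ∀ n, 0 ≤ v n) (hv : Antitone v)
    {x : ℕ → ℂ} {R : ℝ} (hx : ∀ n, v n * ‖x n‖ ≤ R) (n : ℕ) : v n * ‖cesaro x n‖ ≤ R := by
  refine (mul_norm_cesaro_le h0 hv x n).trans ?_
  rw [div_le_iff₀ (by positivity)]
  refine (Finset.sum_le_card_nsmul _ _ R fun i _ => hx i).trans (le_of_eq ?_)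
  simp
  ring

theorem mul_norm_iterate_cesaro_le {v : ℕ → ℝ} (h0 : ∀ n, 0 ≤ v n) (hv : Antitone v)
    {x : ℕ → ℂ} {R : ℝ} (hx : ∀ n, v n * ‖x n‖ ≤ R) (m n : ℕ) :
    v n * ‖cesaro^[m] x n‖ ≤ R := by
  induction m generalizing n with
  | zero => exact hx n
  | succ m ih =>
    rw [Function.iterate_succ_apply']
    exact mul_norm_cesaro_le_of_forall_le h0 hv ih n

theorem cesaro_apply_zero (x : ℕ → ℂ) : cesaro x 0 = x 0 := by simp [cesaro]

theorem iterate_cesaro_apply_zero (x : ℕ → ℂ) (m : ℕ) : cesaro^[m] x 0 = x 0 := by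
  induction m with
  | zero => rfl
  | succ m ih => rw [Function.iterate_succ_apply', cesaro_apply_zero, ih]

/-- On the first `N + 1` entries the Cesàro operator is a strict contraction of the sequences
that vanish at `0`. -/
theorem norm_cesaro_le_of_apply_zero {x : ℕ → ℂ} (hx0 : x 0 = 0) {N : ℕ} {R : ℝ} (hR : 0 ≤ R)
    (hx : ∀ n ≤ N, ‖x n‖ ≤ R) {n : ℕ} (hn : n ≤ N) :
    ‖cesaro x n‖ ≤ (N / (N + 1) : ℝ) * R := by
  -- Only `n` of the `n + 1` averaged terms survive; this produces the factor `n / (n + 1) ≤ N / (N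
  -- + 1)`.
  have hs : ∑ i ∈ Finset.range (n + 1), ‖x i‖ ≤ n * R := by
    rw [Finset.sum_range_succ', hx0, norm_zero, add_zero]
    refine (Finset.sum_le_card_nsmul _ _ R fun i hi => hx _ ?_).trans (by simp)
    have := Finset.mem_range.1 hi
    lia
  refine (norm_cesaro_le x n).trans ((div_le_div_of_nonneg_right hs (by positivity)).trans ?_)
  rw [mul_div_right_comm]
  refine mul_le_mul_of_nonneg_right ?_ hR
  have : (n : ℝ) ≤ N := by exact_mod_cast hn
  rw [div_le_div_iff₀ (by positivity) (by positivity)]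
  linarith

theorem norm_iterate_cesaro_le_of_apply_zero {x : ℕ → ℂ} (hx0 : x 0 = 0) {N : ℕ} {R : ℝ}
    (hR : 0 ≤ R) (hx : ∀ n ≤ N, ‖x n‖ ≤ R) (m : ℕ) {n : ℕ} (hn : n ≤ N) :
    ‖cesaro^[m] x n‖ ≤ (N / (N + 1) : ℝ) ^ m * R := by
  induction m generalizing n with
  | zero => simpa using hx n hn
  | succ m ih =>
    rw [Function.iterate_succ_apply', pow_succ', mul_assoc]
    refine norm_cesaro_le_of_apply_zero ?_ (by positivity) (fun n hn => ih hn) hn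
    rw [iterate_cesaro_apply_zero, hx0]

/-- If `w / v → 0`, then the iterates of the Cesàro operator tend to `0` for the weight `w`,
uniformly on the sequences that vanish at `0` and are bounded for the weight `v`. -/
theorem eventually_mul_norm_iterate_cesaro_le {v w : ℕ → ℝ} (hv0 : ∀ n, 0 < v n)
    (hv : Antitone v) (hw0 : ∀ n, 0 < w n) (hw : Antitone w)
    (hvw : Tendsto (fun n => w n / v n) atTop (𝓝 0)) (R : ℝ) {ε : ℝ} (hε : 0 < ε) :
    ∀ᶠ m in atTop, ∀ x : ℕ → ℂ, x 0 = 0 → (∀ n, v n * ‖x n‖ ≤ R) →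
      ∀ n, w n * ‖cesaro^[m] x n‖ ≤ ε := by
  obtain ⟨N, hN⟩ : ∃ N, ∀ n ≥ N, w n / v n * R < ε := by
    have h := hvw.mul_const R
    rw [zero_mul] at h
    exact eventually_atTop.1 (h.eventually (gt_mem_nhds hε))
  -- On the head `n ≤ N`, monotonicity gives `w n ≤ w 0` and `‖x n‖ ≤ R / v N`.
  have hq : Tendsto (fun m : ℕ => w 0 * ((N / (N + 1) : ℝ) ^ m * (R / v N))) atTop (𝓝 0) := by
    have h1 : (N / (N + 1) : ℝ) < 1 := by
      rw [div_lt_one (by positivity)]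
      linarith
    simpa using ((tendsto_pow_atTop_nhds_zero_of_lt_one (by positivity) h1).mul_const
      (R / v N)).const_mul (w 0)
  filter_upwards [hq.eventually (gt_mem_nhds hε)] with m hm x hx0 hx n
  have hR : 0 ≤ R := (mul_nonneg (hv0 0).le (norm_nonneg _)).trans (hx 0)
  rcases le_total n N with hn | hn
  · have hb : ∀ i ≤ N, ‖x i‖ ≤ R / v N := fun i hi => by
      rw [le_div_iff₀ (hv0 N), mul_comm]
      exact (mul_le_mul_of_nonneg_right (hv hi) (norm_nonneg _)).trans (hx i)
    have h := norm_iterate_cesaro_le_of_apply_zero hx0 (div_nonneg hR (hv0 N).le) hb m hn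
    exact (mul_le_mul (hw n.zero_le) h (norm_nonneg _) (hw0 0).le).trans hm.le
  -- On the tail the bound `R` for `v` survives every iterate, and the ratio `w / v` makes it small.
  · have h := mul_norm_iterate_cesaro_le (fun n => (hv0 n).le) hv hx m n
    refine le_trans ?_ (hN n hn).le
    rw [div_mul_eq_mul_div, le_div_iff₀ (hv0 n)]
    nlinarith [hw0 n]

/-! ### Weighted null sequences -/

theorem mem_c0Submodule_iff {v : ℕ → ℝ} (h0 : ∀ n, 0 ≤ v n) {x : ℕ → ℂ} :
    x ∈ c0Submodule v ↔ Tendsto (fun n => v n * ‖x n‖) atTop (𝓝 0) := by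
  change Tendsto _ _ _ ↔ _
  rw [tendsto_zero_iff_norm_tendsto_zero]
  simp [abs_of_nonneg (h0 _)]

/-- The weighted entries are dominated by the Cesàro means of the null sequence `v n * ‖x n‖`, which
again tend to `0`. -/
theorem cesaro_mem_c0Submodule {v : ℕ → ℝ} (h0 : ∀ n, 0 ≤ v n) (hv : Antitone v) {x : ℕ → ℂ}
    (hx : x ∈ c0Submodule v) : cesaro x ∈ c0Submodule v := by
  rw [mem_c0Submodule_iff h0] at hx ⊢
  refine squeeze_zero (fun n => mul_nonneg (h0 n) (norm_nonneg _)) (mul_norm_cesaro_le h0 hv x) ?_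
  -- `hx.cesaro` averages the first `n` terms, hence the shift by one.
  refine ((tendsto_add_atTop_iff_nat 1).2 hx.cesaro).congr fun n => ?_
  push_cast
  rw [div_eq_inv_mul]

namespace C0

theorem norm_le {v : ℕ → ℝ} (h0 : ∀ n, 0 ≤ v n) {x : C0 v} {R : ℝ}
    (hx : ∀ n, v n * ‖toSeq x n‖ ≤ R) : ‖x‖ ≤ R := by
  rw [norm_def]
  refine ciSup_le fun n => ?_
  rw [norm_mul, Complex.norm_real, Real.norm_of_nonneg (h0 n)]
  exact hx n

theorem mul_norm_toSeq_le {v : ℕ → ℝ} (h0 : ∀ n, 0 ≤ v n) (x : C0 v) (n : ℕ) :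
    v n * ‖toSeq x n‖ ≤ ‖x‖ := by
  have h : ‖(v n : ℂ) * toSeq x n‖ ≤ ‖x‖ := le_ciSup x.bddAbove n
  rwa [norm_mul, Complex.norm_real, Real.norm_of_nonneg (h0 n)] at h

end C0

/-! ### Continuous linear maps and bounded sets in co-echelon spaces -/

namespace IndC0

variable {v : ℕ → ℕ → ℝ}

/-- A linear map on the co-echelon space is continuous as soon as it is on each step. -/
theorem continuous_of_comp_incl {F : Type*} [AddCommGroup F] [Module ℂ F] [Module ℝ F]
    [IsScalarTower ℝ ℂ F] [TopologicalSpace F] [IsTopologicalAddGroup F] [ContinuousSMul ℂ F]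
    [LocallyConvexSpace ℝ F] (T : IndC0 v →ₗ[ℂ] F) (hT : ∀ k, Continuous (T ∘ incl v k)) :
    Continuous T := by
  refine continuous_iff_le_induced.2 (topology_le (fun k => continuous_induced_rng.2 (hT k))
    (topologicalAddGroup_induced _) (continuousSMul_induced _) ?_)
  exact LocallyConvexSpace.induced (T.restrictScalars ℝ : IndC0 v →ₗ[ℝ] F)

/-- A linear map from the co-echelon space to a normed space is continuous as soon as it is
bounded on each step. -/
theorem continuous_of_norm_le {F : Type*} [SeminormedAddCommGroup F] [NormedSpace ℂ F]
    (T : IndC0 v →ₗ[ℂ] F) (hT : ∀ k, ∃ M, ∀ x, ‖T (incl v k x)‖ ≤ M * ‖x‖) : Continuous T := by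
  let _ : NormedSpace ℝ F := NormedSpace.restrictScalars ℝ ℂ F
  have _ : IsScalarTower ℝ ℂ F := ⟨fun a b x => by
    rw [Complex.real_smul, mul_smul]; rfl⟩
  refine continuous_of_comp_incl T fun k => ?_
  obtain ⟨M, hM⟩ := hT k
  exact AddMonoidHomClass.continuous_of_bound (T.comp (incl v k)) M hM

/-- Evaluation at `n`, as a continuous linear functional. -/
def eval (h0 : ∀ k n, 0 < v k n) (n : ℕ) : IndC0 v →L[ℂ] ℂ where
  toLinearMap := (LinearMap.proj n).comp toSeq
  cont := continuous_of_norm_le _ fun k => ⟨(v k n)⁻¹, fun x => by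
    rw [inv_mul_eq_div, le_div_iff₀ (h0 k n), mul_comm]
    exact C0.mul_norm_toSeq_le (fun n => (h0 k n).le) x n⟩

/-- For positive weights decreasing in `k` and any indices `n k`, the quantities
`v k (n k) * ‖x (n k)‖` are bounded in terms of the norm of `x` in any step. -/
theorem exists_forall_mul_norm_le (h0 : ∀ k n, 0 < v k n) (hv : ∀ n, Antitone fun k => v k n)
    (n : ℕ → ℕ) (j : ℕ) :
    ∃ M, ∀ (x : C0 (v j)) (k : ℕ), v k (n k) * ‖C0.toSeq x (n k)‖ ≤ M * ‖x‖ := by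
  -- The ratio `v k / v j` at `n k` is at most `1` for `k ≥ j`; the sum covers the finitely many `k
  -- < j`.
  refine ⟨1 + ∑ k ∈ Finset.range j, v k (n k) / v j (n k), fun x k => ?_⟩
  have hpos : ∀ k, 0 ≤ v k (n k) / v j (n k) := fun k => div_nonneg (h0 _ _).le (h0 _ _).le
  have hx := C0.mul_norm_toSeq_le (fun n => (h0 j n).le) x (n k)
  have hk : v k (n k) / v j (n k) ≤ 1 + ∑ k ∈ Finset.range j, v k (n k) / v j (n k) := by
    rcases lt_or_ge k j with h | h
    · have := Finset.single_le_sum (f := fun k => v k (n k) / v j (n k)) (fun i _ => hpos i)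
        (Finset.mem_range.2 h)
      linarith
    · have h1 : v k (n k) / v j (n k) ≤ 1 := (div_le_one (h0 _ _)).2 (hv _ h)
      have := Finset.sum_nonneg (s := Finset.range j) fun i _ => hpos i
      linarith
  calc v k (n k) * ‖C0.toSeq x (n k)‖
      = v k (n k) / v j (n k) * (v j (n k) * ‖C0.toSeq x (n k)‖) := by
        rw [← mul_assoc, div_mul_cancel₀ _ (h0 _ _).ne']
    _ ≤ _ := mul_le_mul hk hx (mul_nonneg (h0 _ _).le (norm_nonneg _)) ((hpos k).trans hk)

/-- The continuous linear map `x ↦ (v k (n k) * x (n k))_k` to bounded sequences. -/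
theorem exists_sampling (h0 : ∀ k n, 0 < v k n) (hv : ∀ n, Antitone fun k => v k n)
    (n : ℕ → ℕ) :
    ∃ T : IndC0 v →L[ℂ] BoundedContinuousFunction ℕ ℂ,
      ∀ x k, T x k = v k (n k) * toSeq x (n k) := by
  have hnorm : ∀ (x : IndC0 v) k,
      ‖(v k (n k) : ℂ) * toSeq x (n k)‖ = v k (n k) * ‖toSeq x (n k)‖ := fun x k => by
    rw [norm_mul, Complex.norm_real, Real.norm_of_nonneg (h0 _ _).le]
  have hb : ∀ x : IndC0 v, ∃ M, ∀ k, ‖(v k (n k) : ℂ) * toSeq x (n k)‖ ≤ M := fun x => by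
    obtain ⟨j, y, rfl⟩ := exists_mem (fun k n => (h0 k n).le) hv x
    obtain ⟨M, hM⟩ := exists_forall_mul_norm_le h0 hv n j
    exact ⟨M * ‖y‖, fun k => (hnorm _ k).trans_le (hM y k)⟩
  choose M hM using hb
  -- The chosen bound `M x` only certifies boundedness; the values do not depend on it, so `T` is
  -- linear.
  let T : IndC0 v →ₗ[ℂ] BoundedContinuousFunction ℕ ℂ :=
    { toFun := fun x => BoundedContinuousFunction.ofNormedAddCommGroupDiscrete
        (fun k => (v k (n k) : ℂ) * toSeq x (n k)) (M x) (hM x)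
      map_add' := fun x y => by
        ext k
        simp [mul_add]
      map_smul' := fun c x => by
        ext k
        simp [mul_left_comm] }
  refine ⟨⟨T, continuous_of_norm_le T fun j => ?_⟩, fun x k => rfl⟩
  obtain ⟨M, hM⟩ := exists_forall_mul_norm_le h0 hv n j
  refine ⟨M, fun x => (BoundedContinuousFunction.norm_le ?_).2 fun k => ?_⟩
  · exact (mul_nonneg (h0 0 (n 0)).le (norm_nonneg _)).trans (hM x 0)
  · exact (hnorm _ k).trans_le (hM x k)

/-- Bounded sets of the co-echelon space are bounded for one of the weights. -/
theorem exists_forall_mem_mul_norm_le (h0 : ∀ k n, 0 < v k n) (hv : ∀ n, Antitone fun k => v k n)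
    {B : Set (IndC0 v)} (hB : Bornology.IsVonNBounded ℂ B) :
    ∃ k, ∃ R : ℝ, ∀ x ∈ B, ∀ n, v k n * ‖toSeq x n‖ ≤ R := by
  by_contra! h
  -- Diagonal choice: `x k ∈ B` exceeds `k` for the weight `v k` at the index `n k`. Sampling at
  -- these indices then maps `B` to an unbounded set.
  choose x hxB n hn using fun k : ℕ => h k k
  obtain ⟨T, hT⟩ := exists_sampling h0 hv n
  obtain ⟨R, hR⟩ := (NormedSpace.isVonNBounded_iff' ℂ).1 (hB.image T)
  obtain ⟨k, hk⟩ := exists_nat_gt R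
  have h1 := (T (x k)).norm_coe_le_norm k
  rw [hT, norm_mul, Complex.norm_real, Real.norm_of_nonneg (h0 _ _).le] at h1
  linarith [hn k, hR _ (Set.mem_image_of_mem T (hxB k))]

/-! ### The Cesàro operator on a co-echelon space -/

theorem cesaro_mem_indSubmodule (h0 : ∀ k n, 0 ≤ v k n) (hv : ∀ k, Antitone (v k))
    {x : ℕ → ℂ} (hx : x ∈ indSubmodule v) : cesaro x ∈ indSubmodule v := by
  have h : indSubmodule v ≤ (indSubmodule v).comap cesaroLin := iSup_le fun k y hy =>
    Submodule.mem_iSup_of_mem k (cesaro_mem_c0Submodule (h0 k) (hv k) hy)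
  exact h hx

/-- The Cesàro operator as a linear map on a co-echelon space. -/
def cesaroMap (h0 : ∀ k n, 0 ≤ v k n) (hv : ∀ k, Antitone (v k)) : IndC0 v →ₗ[ℂ] IndC0 v :=
  LinearMap.codRestrict (indSubmodule v) (cesaroLin.comp toSeq)
    fun x => cesaro_mem_indSubmodule h0 hv x.2

/-- The Cesàro operator as a linear map on a step. -/
def cesaroStep {w : ℕ → ℝ} (h0 : ∀ n, 0 ≤ w n) (hw : Antitone w) : C0 w →ₗ[ℂ] C0 w :=
  LinearMap.codRestrict (c0Submodule w) (cesaroLin.comp C0.toSeq)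
    fun x => cesaro_mem_c0Submodule h0 hw x.2

/-- The Cesàro operator on a co-echelon space. -/
def cesaroCLM (h0 : ∀ k n, 0 ≤ v k n) (hv : ∀ k, Antitone (v k)) : IndC0 v →L[ℂ] IndC0 v where
  toLinearMap := cesaroMap h0 hv
  cont := by
    refine continuous_of_comp_incl _ fun k => ?_
    have hc : Continuous (cesaroStep (h0 k) (hv k)) := by
      refine AddMonoidHomClass.continuous_of_bound _ 1 fun x => C0.norm_le (h0 k) fun n => ?_
      rw [one_mul]
      exact mul_norm_cesaro_le_of_forall_le (h0 k) (hv k) (C0.mul_norm_toSeq_le (h0 k) x) n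
    exact (continuous_incl k).comp hc

theorem toSeq_cesaroCLM (h0 : ∀ k n, 0 ≤ v k n) (hv : ∀ k, Antitone (v k)) (x : IndC0 v) :
    toSeq (cesaroCLM h0 hv x) = cesaro (toSeq x) := rfl

theorem toSeq_cesaroCLM_pow (h0 : ∀ k n, 0 ≤ v k n) (hv : ∀ k, Antitone (v k)) (m : ℕ)
    (x : IndC0 v) : toSeq ((cesaroCLM h0 hv ^ m) x) = cesaro^[m] (toSeq x) := by
  induction m with
  | zero => rfl
  | succ m ih =>
    rw [pow_succ', mul_apply_eq_comp, toSeq_cesaroCLM, ih,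
      Function.iterate_succ_apply']

/-- Elements whose entries are uniformly small for one of the weights lie in a given
neighbourhood of `0`. -/
theorem exists_pos_forall_mem_of_mem_nhds_zero (h0 : ∀ k n, 0 ≤ v k n) {U : Set (IndC0 v)}
    (hU : U ∈ 𝓝 0) (k : ℕ) :
    ∃ ε > 0, ∀ x : IndC0 v, toSeq x ∈ c0Submodule (v k) →
      (∀ n, v k n * ‖toSeq x n‖ ≤ ε) → x ∈ U := by
  have h : incl v k ⁻¹' U ∈ 𝓝 0 :=
    (continuous_incl k).continuousAt.preimage_mem_nhds (by rwa [map_zero])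
  obtain ⟨ε, hε, hεU⟩ := Metric.mem_nhds_iff.1 h
  refine ⟨ε / 2, half_pos hε, fun x hx hxε => ?_⟩
  have hy : (⟨toSeq x, hx⟩ : c0Submodule (v k)) ∈ (incl v k ⁻¹' U : Set (C0 (v k))) := by
    refine hεU (mem_ball_zero_iff.2 ?_)
    exact (C0.norm_le (v := v k) (h0 k) hxε).trans_lt (half_lt_self hε)
  exact hy

/-- The iterates of the Cesàro operator tend to `0` uniformly on bounded sets of sequences that
vanish at `0`. -/
theorem eventually_forall_cesaroCLM_pow_mem (h0 : ∀ k n, 0 < v k n)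
    (hvk : ∀ n, Antitone fun k => v k n) (hv : ∀ k, Antitone (v k))
    (hvv : ∀ k, Tendsto (fun n => v (k + 1) n / v k n) atTop (𝓝 0))
    {B : Set (IndC0 v)} (hB : Bornology.IsVonNBounded ℂ B) (hB0 : ∀ x ∈ B, toSeq x 0 = 0)
    {U : Set (IndC0 v)} (hU : U ∈ 𝓝 0) :
    ∀ᶠ m in atTop, ∀ x ∈ B, (cesaroCLM (fun k n => (h0 k n).le) hv ^ m) x ∈ U := by
  obtain ⟨k, R, hR⟩ := exists_forall_mem_mul_norm_le h0 hvk hB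
  obtain ⟨ε, hε, hεU⟩ := exists_pos_forall_mem_of_mem_nhds_zero (fun k n => (h0 k n).le) hU (k + 1)
  filter_upwards [eventually_mul_norm_iterate_cesaro_le (h0 k) (hv k) (h0 (k + 1)) (hv (k + 1))
    (hvv k) R hε] with m hm x hx
  refine hεU _ ?_ fun n => ?_
  -- Elements of `B` are only known to be bounded for `v k`; the next weight turns this into a null
  -- sequence.
  · rw [mem_c0Submodule_iff fun n => (h0 _ n).le, toSeq_cesaroCLM_pow]
    have hlim := (hvv k).mul_const R
    rw [zero_mul] at hlim
    refine squeeze_zero (fun n => mul_nonneg (h0 _ n).le (norm_nonneg _)) (fun n => ?_) hlim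
    have h := mul_norm_iterate_cesaro_le (fun n => (h0 k n).le) (hv k) (hR x hx) m n
    rw [div_mul_eq_mul_div, le_div_iff₀ (h0 k n)]
    nlinarith [h0 (k + 1) n]
  · rw [toSeq_cesaroCLM_pow]
    exact hm _ (hB0 x hx) (hR x hx) n

theorem one_mem_indSubmodule (hv1 : ∃ k, Tendsto (v k) atTop (𝓝 0)) :
    (1 : ℕ → ℂ) ∈ indSubmodule v := by
  obtain ⟨k, hk⟩ := hv1
  refine Submodule.mem_iSup_of_mem k ?_
  change Tendsto (fun n => (v k n : ℂ) * 1) atTop (𝓝 0)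
  simp only [mul_one]
  exact_mod_cast (Complex.continuous_ofReal.tendsto 0).comp hk

theorem cesaro_one : cesaro 1 = 1 := by
  funext n
  have h : (n : ℂ) + 1 ≠ 0 := Nat.cast_add_one_ne_zero n
  simp [cesaro, h]

/-- The mean ergodic theorem for the Cesàro operator on a co-echelon space whose linking maps
are compact. -/
theorem cesaro_mean_ergodic (h0 : ∀ k n, 0 < v k n)
    (hvk : ∀ n, Antitone fun k => v k n) (hv : ∀ k, Antitone (v k))
    (hvv : ∀ k, Tendsto (fun n => v (k + 1) n / v k n) atTop (𝓝 0))
    (hv1 : ∃ k, Tendsto (v k) atTop (𝓝 0)) :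
    ∃ (C P : IndC0 v →L[ℂ] IndC0 v) (u : IndC0 v),
      (∀ x, toSeq (C x) = cesaro (toSeq x)) ∧ (∀ n, toSeq u n = 1) ∧ IsIdempotentElem P ∧
      LinearMap.range (P : IndC0 v →ₗ[ℂ] IndC0 v) = Submodule.span ℂ {u} ∧
      LinearMap.ker (P : IndC0 v →ₗ[ℂ] IndC0 v) =
        (LinearMap.range ((1 - C : IndC0 v →L[ℂ] IndC0 v) :
          IndC0 v →ₗ[ℂ] IndC0 v)).topologicalClosure ∧
      Tendsto (fun m : ℕ => C ^ m) atTop (𝓝 P) := by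
  have : T2Space (IndC0 v) := t2Space fun k n => (h0 k n).ne'
  let C := cesaroCLM (fun k n => (h0 k n).le) hv
  let u : IndC0 v := ⟨1, one_mem_indSubmodule hv1⟩
  have hu : toSeq u = 1 := rfl
  let P : IndC0 v →L[ℂ] IndC0 v := (eval h0 0).smulRight u
  have hP : ∀ x, P x = toSeq x 0 • u := fun x => rfl
  have hP0 : ∀ x, P x = 0 ↔ toSeq x 0 = 0 := fun x => by
    refine ⟨fun h => ?_, fun h => by rw [hP, h, zero_smul]⟩
    have := congrFun (congrArg toSeq h) 0
    simpa [hP, hu] using this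
  have hPu : P u = u := by rw [hP, hu, Pi.one_apply, one_smul]
  have hPP : ∀ x, P (P x) = P x := fun x => by rw [hP x, map_smul, hPu]
  have hCu : C u = u := toSeq_injective ((toSeq_cesaroCLM _ hv u).trans cesaro_one)
  have hCP : ∀ m x, (C ^ m) (P x) = P x := fun m x => by
    induction m with
    | zero => rfl
    | succ m ih => rw [pow_succ', mul_apply_eq_comp, ih, hP, map_smul, hCu]
  -- Since `C^m P = P`, the difference is `C^m` applied to `(1 - P) x`, which vanishes at `0` and
  -- ranges over a bounded set.
  have hlim : ∀ B : Set (IndC0 v), Bornology.IsVonNBounded ℂ B → ∀ U ∈ 𝓝 (0 : IndC0 v),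
      ∀ᶠ m in atTop, ∀ x ∈ B, (C ^ m) x - P x ∈ U := fun B hB U hU => by
    have h := eventually_forall_cesaroCLM_pow_mem h0 hvk hv hvv
      (hB.image (1 - P)) (fun y hy => ?_) hU
    · filter_upwards [h] with m hm x hx
      have := hm _ (Set.mem_image_of_mem _ hx)
      rwa [sub_apply, one_apply_eq_self, map_sub, hCP] at this
    · obtain ⟨x, -, rfl⟩ := hy
      rw [← hP0, sub_apply, one_apply_eq_self, map_sub, hPP,
        sub_self]
  refine ⟨C, P, u, toSeq_cesaroCLM _ hv, fun n => rfl, ContinuousLinearMap.ext hPP, ?_, ?_, ?_⟩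
  · refine le_antisymm ?_ ((Submodule.span_singleton_le_iff_mem _ _).2 ⟨u, hPu⟩)
    rintro _ ⟨x, rfl⟩
    exact Submodule.smul_mem _ _ (Submodule.mem_span_singleton_self u)
  · refine le_antisymm (fun x hx => ?_) ?_
    · have hx0 : P x = 0 := hx
      have hxm : Tendsto (fun m : ℕ => x - (C ^ m) x) atTop (𝓝 x) := by
        have : Tendsto (fun m : ℕ => (C ^ m) x) atTop (𝓝 0) := by
          refine tendsto_def.2 fun U hU => ?_
          filter_upwards [hlim {x} (Bornology.isVonNBounded_singleton x) U hU] with m hm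
          simpa [hx0] using hm x rfl
        simpa using this.const_sub x
      refine mem_closure_of_tendsto hxm (Eventually.of_forall fun m => ?_)
      -- Telescoping: `(1 - C) * ∑ i < m, C^i = 1 - C^m`.
      refine ⟨(∑ i ∈ Finset.range m, C ^ i) x, ?_⟩
      exact congrArg (fun T : IndC0 v →L[ℂ] IndC0 v => T x) (mul_neg_geom_sum C m)
    · refine Submodule.topologicalClosure_minimal _ ?_ P.isClosed_ker
      rintro _ ⟨x, rfl⟩
      refine (hP0 _).2 ?_
      change toSeq (x - C x) 0 = 0
      rw [map_sub, Pi.sub_apply, toSeq_cesaroCLM, cesaro_apply_zero, sub_self]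
  · rw [← tendsto_sub_nhds_zero_iff]
    refine (ContinuousLinearMap.hasBasis_nhds_zero).tendsto_right_iff.2 fun ⟨B, U⟩ ⟨hB, hU⟩ => ?_
    exact hlim B hB U hU

end IndC0

/-! ### Power weights -/

theorem tendsto_rpow_neg_of_one_lt {b : ℝ} (hb : 1 < b) {α : ℕ → ℝ} (hα : Tendsto α atTop atTop) :
    Tendsto (fun n => b ^ (-α n)) atTop (𝓝 0) :=
  (tendsto_rpow_atBot_of_base_gt_one b hb).comp (tendsto_neg_atTop_atBot.comp hα)

theorem weight_pos {α s : ℕ → ℝ} (hs : ∀ k, 1 < s k) (k n : ℕ) : 0 < weight α s k n :=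
  Real.rpow_pos_of_pos (zero_lt_one.trans (hs k)) _

theorem weight_antitone_left {α s : ℕ → ℝ} (hα : ∀ n, 0 < α n) (hs : ∀ k, 1 < s k)
    (hs_mono : Monotone s) (n : ℕ) : Antitone fun k => weight α s k n := fun k _ hkl =>
  Real.rpow_le_rpow_of_nonpos (zero_lt_one.trans (hs k)) (hs_mono hkl) (neg_nonpos.2 (hα n).le)

theorem weight_antitone_right {α s : ℕ → ℝ} (hα : Monotone α) (hs : ∀ k, 1 < s k) (k : ℕ) :
    Antitone (weight α s k) := fun _ _ hmn =>
  Real.rpow_le_rpow_of_exponent_le (hs k).le (neg_le_neg (hα hmn))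

/-- The ratio is `(s (k + 1) / s k) ^ (-α n)`, with base greater than `1`. -/
theorem tendsto_weight_succ_div {α s : ℕ → ℝ} (hα : Tendsto α atTop atTop) (hs : ∀ k, 1 < s k)
    (hs_mono : StrictMono s) (k : ℕ) :
    Tendsto (fun n => weight α s (k + 1) n / weight α s k n) atTop (𝓝 0) := by
  have h0 : ∀ k, 0 < s k := fun k => zero_lt_one.trans (hs k)
  have h : 1 < s (k + 1) / s k := (one_lt_div (h0 k)).2 (hs_mono k.lt_succ_self)
  refine (tendsto_rpow_neg_of_one_lt h hα).congr fun n => ?_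
  exact Real.div_rpow (h0 _).le (h0 _).le _

end CesaroCoechelon

end

/-- Here `E α s →L[ℂ] E α s` carries Mathlib's topology of uniform convergence on (von Neumann)
bounded sets, so that the limit is taken in `L_b(E_α)`. -/
theorem proposition4p2 (α s : ℕ → ℝ)
    (hα_pos : ∀ n, 0 < α n) (hα_mono : StrictMono α) (hα_lim : Filter.Tendsto α Filter.atTop Filter.atTop)
    (hs_one : ∀ k, 1 < s k) (hs_mono : StrictMono s) (hs_lim : Filter.Tendsto s Filter.atTop Filter.atTop) :
    ∃ (C P : CesaroCoechelon.E α s →L[ℂ] CesaroCoechelon.E α s) (u : CesaroCoechelon.E α s),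
      (∀ x, CesaroCoechelon.IndC0.toSeq (C x) =
        CesaroCoechelon.cesaro (CesaroCoechelon.IndC0.toSeq x)) ∧
      (∀ n, CesaroCoechelon.IndC0.toSeq u n = 1) ∧
      IsIdempotentElem P ∧
      LinearMap.range (P : CesaroCoechelon.E α s →ₗ[ℂ] CesaroCoechelon.E α s) =
        Submodule.span ℂ {u} ∧
      LinearMap.ker (P : CesaroCoechelon.E α s →ₗ[ℂ] CesaroCoechelon.E α s) =
        (LinearMap.range ((1 - C : CesaroCoechelon.E α s →L[ℂ] CesaroCoechelon.E α s) :
          CesaroCoechelon.E α s →ₗ[ℂ] CesaroCoechelon.E α s)).topologicalClosure ∧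
      Filter.Tendsto (fun m : ℕ => C ^ m) Filter.atTop (𝓝 P) :=
  CesaroCoechelon.IndC0.cesaro_mean_ergodic (CesaroCoechelon.weight_pos hs_one)
    (CesaroCoechelon.weight_antitone_left hα_pos hs_one hs_mono.monotone)
    (CesaroCoechelon.weight_antitone_right hα_mono.monotone hs_one)
    (CesaroCoechelon.tendsto_weight_succ_div hα_lim hs_one hs_mono)
    ⟨0, CesaroCoechelon.tendsto_rpow_neg_of_one_lt (hs_one 0) hα_lim⟩
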